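/- A graphon is a symmetric measurable function $[0,1]^2\to[0,1]$. A $3$-hypergraphon is a measurable function $W:[0,1]^6\to[0,1]$, written $W(x_1,x_2,x_3,x_{12},x_{13},x_{23})$, such that $$W(x_1,x_2,x_3,x_{12},x_{13},x_{23})=W(x_{\sigma(1)},x_{\sigma(2)},x_{\sigma(3)},x_{\sigma(1)\sigma(2)},x_{\sigma(1)\sigma(3)},x_{\sigma(2)\sigma(3)})$$ for every permutation $\sigma$ of $\{1,2,3\}$, where $x_{ij}=x_{ji}$. Its vertex-vertex intersection graphon is $$B(W)(x_1,x_4)=\frac12\int_{[0,1]^7}W(x_1,x_2,x_3,x_{12},x_{13},x_{23})\,W(x_2,x_3,x_4,x_{23},x_{24},x_{34})\,\mathrm dx_2\,\mathrm dx_3\,\mathrm dx_{12}\,\mathrm dx_{13}\,\mathrm dx_{23}\,\mathrm dx_{24}\,\mathrm dx_{34}.$$ For $3$-hypergraphons $W,U$ the $2$-cut norm of their difference is $$\|W-U\|_{\square,2}=\sup_{f,g,h}\Big|\int_{[0,1]^6}(W-U)(x_1,x_2,x_3,x_{12},x_{13},x_{23})\,f(x_1,x_2,x_{12})\,g(x_2,x_3,x_{23})\,h(x_1,x_3,x_{13})\,\mathrm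 dx_1\,\mathrm dx_2\,\mathrm dx_3\,\mathrm dx_{12}\,\mathrm dx_{13}\,\mathrm dx_{23}\Big|,$$ the supremum being over measurable $f,g,h:[0,1]^3\to[0,1]$ that are symmetric in their first two arguments. For a bounded measurable $V:[0,1]^2\to\mathbb R$ the cut norm is $\|V\|_\square=\sup_{f,g}\big|\int_{[0,1]^2}V(x,y)f(x)g(y)\,\mathrm dx\,\mathrm dy\big|$, the supremum being over measurable $f,g:[0,1]\to[0,1]$. For a graphon $V$, let $\mathcal A_V$ be the (compact, self-adjoint) operator on the real Hilbert space $L^2([0,1])$ given by $(\mathcal A_Vf)(x)=\int_0^1V(x,y)f(y)\,\mathrm dy$; let $\lambda_1(V)\ge\lambda_2(V)\ge\dots\ge 0$ be its positive eigenvalues and $\lambda_1'(V)\le\lambda_2'(V)\le\dots\le 0$ its negative eigenvalues, listed with multiplicity, each list being continued by zeros if it is finite. **Corollary.** Let $(W_n)_n$ be a sequence of $3$-hypergraphons and $W$ a $3$-hypergraphon with $\|W_n-W\|_{\square,2}\to0$. Then $\|B(W_n)-B(W)\|_\square\to0$. Moreover, the spectra of the operators $\mathcal A_{B(W_n)}$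 converge pointwise to the spectrum of $\mathcal A_{B(W)}$: for every $i\ge1$, $\lambda_i(B(W_n))\to\lambda_i(B(W))$ and $\lambda'_i(B(W_n))\to\lambda'_i(B(W))$ as $n\to\infty$. -/

import Mathlib

open MeasureTheory Filter Topology
open scoped unitInterval

noncomputable section

/-- A graphon: a symmetric measurable function from the unit square to `[0,1]`. -/
structure Graphon where
  toFun : I × I → ℝ
  measurable' : Measurable toFun
  symm' : ∀ x y, toFun (x, y) = toFun (y, x)
  mem_Icc' : ∀ p, toFun p ∈ Set.Icc (0 : ℝ) 1

/-- The cut norm of a (bounded measurable) function on the unit square: the supremum of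
`|∫ U(x,y) f(x) g(y) dx dy|` over measurable `f, g : [0,1] → [0,1]`. -/
def cutNorm (U : I × I → ℝ) : ℝ :=
  sSup {r : ℝ | ∃ f g : I → I, Measurable f ∧ Measurable g ∧
    r = |∫ p : I × I, U p * (f p.1 : ℝ) * (g p.2 : ℝ)|}

/-- A 3-hypergraphon: a measurable function `W(x₁,x₂,x₃,x₁₂,x₁₃,x₂₃)` from `[0,1]⁶` to `[0,1]`
which is invariant under the simultaneous action of the permutations of `{1,2,3}` on the vertex
coordinates `xᵢ` and on the edge coordinates `xᵢⱼ = xⱼᵢ`. -/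
structure Hypergraphon3 where
  toFun : I × I × I × I × I × I → ℝ
  measurable' : Measurable toFun
  mem_Icc' : ∀ p, toFun p ∈ Set.Icc (0 : ℝ) 1
  symm' : ∀ (τ : Equiv.Perm (Fin 3)) (x : Fin 3 → I) (y : Fin 3 → Fin 3 → I),
    (∀ i j, y i j = y j i) →
    toFun (x 0, x 1, x 2, y 0 1, y 0 2, y 1 2) =
      toFun (x (τ 0), x (τ 1), x (τ 2), y (τ 0) (τ 1), y (τ 0) (τ 2), y (τ 1) (τ 2))

/-- A test function for the 2-cut norm: a measurable function `f(x₁,x₂,x₁₂)` from `[0,1]³` to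
`[0,1]` which is symmetric in the two vertex coordinates. -/
def IsCutTest (f : I × I × I → I) : Prop :=
  Measurable f ∧ ∀ x₁ x₂ x₁₂, f (x₁, x₂, x₁₂) = f (x₂, x₁, x₁₂)

/-- The 2-cut norm of a (bounded measurable) function of `(x₁,x₂,x₃,x₁₂,x₁₃,x₂₃) ∈ [0,1]⁶`. -/
def cutNorm2 (U : I × I × I × I × I × I → ℝ) : ℝ :=
  sSup {r : ℝ | ∃ f g h : I × I × I → I, IsCutTest f ∧ IsCutTest g ∧ IsCutTest h ∧
    r = abs (∫ p : I × I × I × I × I × I,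
      match p with
      | (x₁, x₂, x₃, x₁₂, x₁₃, x₂₃) =>
        U (x₁, x₂, x₃, x₁₂, x₁₃, x₂₃) *
          ((f (x₁, x₂, x₁₂) : ℝ) * (g (x₂, x₃, x₂₃) : ℝ) * (h (x₁, x₃, x₁₃) : ℝ)))}

namespace Hypergraphon3

/-- The function `B(W)(x₁,x₄)`, the integral over all seven remaining coordinates. -/
def interFun (W : Hypergraphon3) (q : I × I) : ℝ :=
  (1 / 2) * ∫ p : (I × I × I) × (I × I) × (I × I),
    match q, p with
    | (x₁, x₄), ((x₂, x₃, x₂₃), (x₁₂, x₁₃), (x₂₄, x₃₄)) =>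
      W.toFun (x₁, x₂, x₃, x₁₂, x₁₃, x₂₃) * W.toFun (x₂, x₃, x₄, x₂₃, x₂₄, x₃₄)

theorem rotate (W : Hypergraphon3) (a b c d e f : I) :
    W.toFun (a, b, c, d, e, f) = W.toFun (b, c, a, f, d, e) := by
  have h := W.symm' (finRotate 3) ![a, b, c] ![![a, d, e], ![d, a, f], ![e, f, a]]
    (by intro i j; fin_cases i <;> fin_cases j <;> rfl)
  exact h

theorem interFun_measurable (W : Hypergraphon3) : Measurable W.interFun := by
  have hW := W.measurable'
  refine Measurable.const_mul ?_ _
  have h : Measurable (fun z : (I × I) × ((I × I × I) × (I × I) × (I × I)) =>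
      W.toFun (z.1.1, z.2.1.1, z.2.1.2.1, z.2.2.1.1, z.2.2.1.2, z.2.1.2.2) *
      W.toFun (z.2.1.1, z.2.1.2.1, z.1.2, z.2.1.2.2, z.2.2.2.1, z.2.2.2.2)) := by
    fun_prop
  exact (h.stronglyMeasurable.integral_prod_right').measurable

theorem interFun_symm (W : Hypergraphon3) (x y : I) : W.interFun (x, y) = W.interFun (y, x) := by
  unfold interFun
  congr 1
  have hm : MeasurePreserving
      (fun p : (I × I × I) × (I × I) × (I × I) => (p.1, p.2.swap)) volume volume :=
    (MeasurePreserving.id (volume : Measure (I × I × I))).prod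
      (Measure.measurePreserving_swap (μ := (volume : Measure (I × I)))
        (ν := (volume : Measure (I × I))))
  have he : MeasurableEmbedding
      (fun p : (I × I × I) × (I × I) × (I × I) => (p.1, p.2.swap)) :=
    ((MeasurableEquiv.refl (I × I × I)).prodCongr
      (MeasurableEquiv.prodComm (α := I × I) (β := I × I))).measurableEmbedding
  rw [← hm.integral_comp he]
  refine integral_congr_ae (Eventually.of_forall ?_)
  rintro ⟨⟨x₂, x₃, x₂₃⟩, ⟨x₁₂, x₁₃⟩, ⟨x₂₄, x₃₄⟩⟩
  change W.toFun (x, x₂, x₃, x₂₄, x₃₄, x₂₃) * W.toFun (x₂, x₃, y, x₂₃, x₁₂, x₁₃) =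
    W.toFun (y, x₂, x₃, x₁₂, x₁₃, x₂₃) * W.toFun (x₂, x₃, x, x₂₃, x₂₄, x₃₄)
  rw [W.rotate x, W.rotate y, mul_comm]

theorem interFun_mem_Icc (W : Hypergraphon3) (q : I × I) : W.interFun q ∈ Set.Icc (0 : ℝ) 1 := by
  obtain ⟨x₁, x₄⟩ := q
  have h0 : ∀ p, 0 ≤ W.toFun p := fun p => (W.mem_Icc' p).1
  have h1 : ∀ p, W.toFun p ≤ 1 := fun p => (W.mem_Icc' p).2
  have hle : (∫ p : (I × I × I) × (I × I) × (I × I),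
      W.toFun (x₁, p.1.1, p.1.2.1, p.2.1.1, p.2.1.2, p.1.2.2) *
      W.toFun (p.1.1, p.1.2.1, x₄, p.1.2.2, p.2.2.1, p.2.2.2)) ≤ 1 := by
    refine (integral_mono_of_nonneg (Eventually.of_forall fun p => mul_nonneg (h0 _) (h0 _))
      (integrable_const (1 : ℝ))
      (Eventually.of_forall fun p => mul_le_one₀ (h1 _) (h0 _) (h1 _))).trans ?_
    simp
  have hge : 0 ≤ (∫ p : (I × I × I) × (I × I) × (I × I),
      W.toFun (x₁, p.1.1, p.1.2.1, p.2.1.1, p.2.1.2, p.1.2.2) *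
      W.toFun (p.1.1, p.1.2.1, x₄, p.1.2.2, p.2.2.1, p.2.2.2)) :=
    integral_nonneg fun p => mul_nonneg (h0 _) (h0 _)
  refine ⟨mul_nonneg (by norm_num) hge, ?_⟩
  refine (mul_le_mul_of_nonneg_left hle (by norm_num : (0 : ℝ) ≤ 1 / 2)).trans (by norm_num)

/-- The vertex-vertex intersection graphon `B(W)` of a 3-hypergraphon `W`. -/
def inter (W : Hypergraphon3) : Graphon where
  toFun := W.interFun
  measurable' := W.interFun_measurable
  symm' := W.interFun_symm
  mem_Icc' := W.interFun_mem_Icc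

end Hypergraphon3

/-- The real Hilbert space `L²([0,1])`. -/
abbrev L2I : Type := Lp ℝ 2 (volume : Measure I)

namespace Graphon

theorem integrable_mul (W : Graphon) (f : L2I) (x : I) :
    Integrable (fun y => W.toFun (x, y) * f y) := by
  have hW := W.measurable'
  have hf : Integrable (f : I → ℝ) := (Lp.memLp f).integrable (by norm_num)
  refine hf.bdd_mul (c := 1) (hW.comp measurable_prodMk_left).aestronglyMeasurable (Eventually.of_forall fun y => ?_)
  rw [Real.norm_eq_abs, abs_of_nonneg (W.mem_Icc' _).1]
  exact (W.mem_Icc' _).2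

theorem norm_integral_le (W : Graphon) (f : L2I) (x : I) :
    ‖∫ y, W.toFun (x, y) * f y‖ ≤ ‖f‖ := by
  have hf : Integrable (f : I → ℝ) := (Lp.memLp f).integrable (by norm_num)
  have h1 : ‖∫ y, W.toFun (x, y) * f y‖ ≤ ∫ y, ‖f y‖ := by
    refine (norm_integral_le_integral_norm _).trans
      (integral_mono (W.integrable_mul f x).norm hf.norm fun y => ?_)
    change ‖W.toFun (x, y) * f y‖ ≤ ‖f y‖
    rw [norm_mul, Real.norm_eq_abs, abs_of_nonneg (W.mem_Icc' _).1]
    exact mul_le_of_le_one_left (norm_nonneg _) (W.mem_Icc' _).2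
  refine h1.trans ?_
  rw [integral_norm_eq_lintegral_enorm hf.aestronglyMeasurable, ← eLpNorm_one_eq_lintegral_enorm,
    Lp.norm_def]
  exact ENNReal.toReal_mono (Lp.eLpNorm_ne_top f)
    (eLpNorm_le_eLpNorm_of_exponent_le (by norm_num) (Lp.aestronglyMeasurable f))

theorem memLp_integral (W : Graphon) (f : L2I) :
    MemLp (fun x => ∫ y, W.toFun (x, y) * f y) 2 (volume : Measure I) := by
  refine MemLp.of_bound ?_ ‖f‖ (Eventually.of_forall fun x => W.norm_integral_le f x)
  have h : Measurable (fun z : I × I => W.toFun z * f z.2) :=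
    W.measurable'.mul ((Lp.stronglyMeasurable f).measurable.comp measurable_snd)
  exact (h.stronglyMeasurable.integral_prod_right').aestronglyMeasurable

/-- The kernel operator `A_W : L²([0,1]) → L²([0,1])`, `(A_W f)(x) = ∫ W(x,y) f(y) dy`. -/
def kernelOp (W : Graphon) : L2I →L[ℝ] L2I :=
  LinearMap.mkContinuous
    { toFun := fun f => (W.memLp_integral f).toLp (fun x => ∫ y, W.toFun (x, y) * f y)
      map_add' := fun f g => by
        rw [← MemLp.toLp_add]
        refine MemLp.toLp_congr _ _ (Eventually.of_forall fun x => ?_)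
        change _ = (∫ y, W.toFun (x, y) * f y) + ∫ y, W.toFun (x, y) * g y
        rw [← integral_add (W.integrable_mul f x) (W.integrable_mul g x)]
        refine integral_congr_ae ?_
        filter_upwards [Lp.coeFn_add f g] with y hy
        rw [hy, Pi.add_apply, mul_add]
      map_smul' := fun c f => by
        rw [RingHom.id_apply, ← MemLp.toLp_const_smul]
        refine MemLp.toLp_congr _ _ (Eventually.of_forall fun x => ?_)
        change _ = c * ∫ y, W.toFun (x, y) * f y
        rw [← integral_const_mul]
        refine integral_congr_ae ?_
        filter_upwards [Lp.coeFn_smul c f] with y hy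
        rw [hy, Pi.smul_apply, smul_eq_mul, mul_left_comm] }
    1 (fun f => by
      refine Lp.norm_le_of_ae_bound (norm_nonneg f) ?_ |>.trans ?_
      · filter_upwards [(W.memLp_integral f).coeFn_toLp] with x hx
        exact hx ▸ W.norm_integral_le f x
      · simp [measureUnivNNReal])

/-- The defining formula of the kernel operator. -/
theorem kernelOp_ae_eq (W : Graphon) (f : L2I) :
    (W.kernelOp f : I → ℝ) =ᵐ[volume] fun x => ∫ y, W.toFun (x, y) * f y :=
  (W.memLp_integral f).coeFn_toLp

end Graphon

/-- The `(k+1)`-st largest positive eigenvalue of a compact self-adjoint operator `T`, counted with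
multiplicity (`k = 0, 1, 2, …`): the largest eigenvalue `μ > 0` such that the eigenvalues `≥ μ` have
total multiplicity at least `k + 1`. If there are at most `k` positive eigenvalues it is
`sSup ∅ = 0`. -/
def posEigenvalue (T : L2I →L[ℝ] L2I) (k : ℕ) : ℝ :=
  sSup {μ : ℝ | 0 < μ ∧ Module.End.HasEigenvalue (T : Module.End ℝ L2I) μ ∧
    (k : Cardinal) < Module.rank ℝ
      ↥(⨆ ν ∈ Set.Ici μ, Module.End.eigenspace (T : Module.End ℝ L2I) ν)}

/-- The `(k+1)`-st smallest negative eigenvalue of a compact self-adjoint operator `T`, counted with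
multiplicity; it is `0` if there are at most `k` negative eigenvalues. -/
def negEigenvalue (T : L2I →L[ℝ] L2I) (k : ℕ) : ℝ :=
  sInf {μ : ℝ | μ < 0 ∧ Module.End.HasEigenvalue (T : Module.End ℝ L2I) μ ∧
    (k : Cardinal) < Module.rank ℝ
      ↥(⨆ ν ∈ Set.Iic μ, Module.End.eigenspace (T : Module.End ℝ L2I) ν)}

/-- Pointwise convergence of the spectra of compact self-adjoint operators: the ordered sequence of
positive eigenvalues and the ordered sequence of negative eigenvalues, both with multiplicity and
continued by zeros, converge term by term. -/
def SpectraConverge (T : ℕ → L2I →L[ℝ] L2I) (S : L2I →L[ℝ] L2I) : Prop :=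
  ∀ k : ℕ, Tendsto (fun n => posEigenvalue (T n) k) atTop (𝓝 (posEigenvalue S k)) ∧
    Tendsto (fun n => negEigenvalue (T n) k) atTop (𝓝 (negEigenvalue S k))

end

/-! ### Spectral subspaces and quadratic forms of compact symmetric operators -/

section CompactSymmetric

open Module.End

variable {E : Type*} [NormedAddCommGroup E] [InnerProductSpace ℝ E]

/-! Two estimates combine.

Counting: by the symmetry of `W`, `B(W)` is half the integral of two copies of `W` glued along `x₂,
x₃, x₂₃`. The difference of two such products telescopes into two terms, each with one factor `W -
W'`. Integrating out the coordinates `x₄, x₂₄, x₃₄` private to the other copy turns that copy,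
together with the test function of `x₄`, into an admissible test function of `(x₂, x₃, x₂₃)`. The
remaining test function of the single vertex `x₁` is not symmetric in two vertices, but it is a
signed sum of three functions that are. Hence the cut norm of `B(W) - B(W')` is at most 3 times the
2-cut norm of `W - W'` (`cutNorm_inter_sub_le`).

Spectrum: truncating `L²` functions at height `M` bounds the operator norm of a difference of kernel
operators by `4M²` times the cut norm plus `2/M` (`norm_kernelOp_sub_le`), so cut norm convergence
gives operator norm convergence. Kernel operators are symmetric and Hilbert–Schmidt, hence compact,
and Weyl's inequality (`posEigenvalue_le_add_norm_sub`) makes each ordered positive eigenvalue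
1-Lipschitz in the operator norm. Negative eigenvalues follow by passing to `-T`. -/

theorem exists_finsupp_of_mem_iSup_eigenspace {T : E →ₗ[ℝ] E} {S : Set ℝ} {x : E}
    (hx : x ∈ ⨆ ν ∈ S, eigenspace T ν) :
    ∃ f : ℝ →₀ E, (∀ ν ∈ f.support, ν ∈ S) ∧ (∀ ν, f ν ∈ eigenspace T ν) ∧
      ∑ ν ∈ f.support, f ν = x := by
  obtain ⟨f, hf, hsum⟩ := (Submodule.mem_iSup_iff_exists_finsupp _ _).1 hx
  have hmem : ∀ ν, f ν ≠ 0 → ν ∈ S := fun ν hν => by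
    by_contra hS
    exact hν (by simpa [hS] using hf ν)
  refine ⟨f, fun ν hν => hmem ν (Finsupp.mem_support_iff.1 hν), fun ν => ?_, hsum⟩
  by_cases h : f ν = 0
  · rw [h]; exact Submodule.zero_mem _
  · simpa [hmem ν h] using hf ν

theorem inner_map_finset_sum_eigenvectors {T : E →ₗ[ℝ] E} (hT : T.IsSymmetric) (s : Finset ℝ)
    {f : ℝ → E} (hf : ∀ ν, f ν ∈ eigenspace T ν) :
    inner ℝ (T (∑ ν ∈ s, f ν)) (∑ ν ∈ s, f ν) = ∑ ν ∈ s, ν * ‖f ν‖ ^ 2 := by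
  have horth : ∀ ν μ, ν ≠ μ → inner ℝ (f ν) (f μ) = 0 := fun ν μ h =>
    hT.orthogonalFamily_eigenspaces h ⟨f ν, hf ν⟩ ⟨f μ, hf μ⟩
  rw [map_sum, sum_inner]
  refine Finset.sum_congr rfl fun ν hν => ?_
  rw [mem_eigenspace_iff.1 (hf ν), inner_smul_left, inner_sum,
    Finset.sum_eq_single_of_mem ν hν fun μ _ h => horth ν μ h.symm, real_inner_self_eq_norm_sq]
  rfl

theorem norm_sq_finset_sum_eigenvectors {T : E →ₗ[ℝ] E} (hT : T.IsSymmetric) (s : Finset ℝ)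
    {f : ℝ → E} (hf : ∀ ν, f ν ∈ eigenspace T ν) :
    ‖∑ ν ∈ s, f ν‖ ^ 2 = ∑ ν ∈ s, ‖f ν‖ ^ 2 := by
  have horth : ∀ ν μ, ν ≠ μ → inner ℝ (f ν) (f μ) = 0 := fun ν μ h =>
    hT.orthogonalFamily_eigenspaces h ⟨f ν, hf ν⟩ ⟨f μ, hf μ⟩
  rw [← real_inner_self_eq_norm_sq, sum_inner]
  refine Finset.sum_congr rfl fun ν hν => ?_
  rw [inner_sum, Finset.sum_eq_single_of_mem ν hν fun μ _ h => horth ν μ h.symm,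
    real_inner_self_eq_norm_sq]

theorem le_inner_map_of_mem_iSup_eigenspace {T : E →ₗ[ℝ] E} (hT : T.IsSymmetric) {S : Set ℝ}
    {t : ℝ} (hS : ∀ ν ∈ S, t ≤ ν) {x : E} (hx : x ∈ ⨆ ν ∈ S, eigenspace T ν) :
    t * ‖x‖ ^ 2 ≤ inner ℝ (T x) x := by
  obtain ⟨f, hfS, hf, rfl⟩ := exists_finsupp_of_mem_iSup_eigenspace hx
  rw [inner_map_finset_sum_eigenvectors hT _ hf, norm_sq_finset_sum_eigenvectors hT _ hf,
    Finset.mul_sum]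
  exact Finset.sum_le_sum fun ν hν => mul_le_mul_of_nonneg_right (hS ν (hfS ν hν)) (sq_nonneg _)

theorem inner_map_le_of_mem_iSup_eigenspace {T : E →ₗ[ℝ] E} (hT : T.IsSymmetric) {S : Set ℝ}
    {t : ℝ} (hS : ∀ ν ∈ S, ν ≤ t) {x : E} (hx : x ∈ ⨆ ν ∈ S, eigenspace T ν) :
    inner ℝ (T x) x ≤ t * ‖x‖ ^ 2 := by
  obtain ⟨f, hfS, hf, rfl⟩ := exists_finsupp_of_mem_iSup_eigenspace hx
  rw [inner_map_finset_sum_eigenvectors hT _ hf, norm_sq_finset_sum_eigenvectors hT _ hf,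
    Finset.mul_sum]
  exact Finset.sum_le_sum fun ν hν => mul_le_mul_of_nonneg_right (hS ν (hfS ν hν)) (sq_nonneg _)

theorem isOrtho_iSup_eigenspace {T : E →ₗ[ℝ] E} (hT : T.IsSymmetric) {S S' : Set ℝ}
    (h : Disjoint S S') : (⨆ ν ∈ S, eigenspace T ν) ⟂ (⨆ ν ∈ S', eigenspace T ν) := by
  simp only [Submodule.isOrtho_iSup_left, Submodule.isOrtho_iSup_right]
  intro μ hμ ν hν
  rw [Submodule.isOrtho_iff_inner_eq]
  intro x hx y hy
  exact hT.orthogonalFamily_eigenspaces (fun h' : ν = μ => Set.disjoint_left.1 h hν (h' ▸ hμ))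
    ⟨x, hx⟩ ⟨y, hy⟩

/-- `posEigenvalue` ranges over eigenvalues only, while min-max arguments yield an arbitrary level
`s`. Among `k + 1` independent vectors, each a finite sum of eigenvectors, only finitely many
eigenvalues occur; the smallest one serves as `μ`. -/
theorem exists_hasEigenvalue_of_lt_rank {T : E →ₗ[ℝ] E} {s : ℝ} {k : ℕ}
    (hk : (k : Cardinal) < Module.rank ℝ ↥(⨆ ν ∈ Set.Ici s, eigenspace T ν)) :
    ∃ μ, s ≤ μ ∧ HasEigenvalue T μ ∧
      (k : Cardinal) < Module.rank ℝ ↥(⨆ ν ∈ Set.Ici μ, eigenspace T ν) := by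
  have hk' : ((k + 1 : ℕ) : Cardinal) ≤ Module.rank ℝ ↥(⨆ ν ∈ Set.Ici s, eigenspace T ν) := by
    rw [Nat.cast_succ, ← Cardinal.succ_natCast]
    exact Order.succ_le_of_lt hk
  obtain ⟨v, hv⟩ := Module.le_rank_iff.1 hk'
  have h1 : ∀ i, ∃ μ, s ≤ μ ∧ HasEigenvalue T μ ∧
      (v i : E) ∈ ⨆ ν ∈ Set.Ici μ, eigenspace T ν := fun i => by
    obtain ⟨f, hfS, hf, hsum⟩ := exists_finsupp_of_mem_iSup_eigenspace (v i).2
    have hne : f.support.Nonempty := by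
      by_contra h
      rw [Finset.not_nonempty_iff_eq_empty.1 h, Finset.sum_empty] at hsum
      exact hv.ne_zero i (Subtype.ext hsum.symm)
    refine ⟨f.support.min' hne, hfS _ (Finset.min'_mem _ _),
      hasEigenvalue_of_hasEigenvector
        ⟨hf _, Finsupp.mem_support_iff.1 (f.support.min'_mem hne)⟩, ?_⟩
    rw [← hsum]
    refine Submodule.sum_mem _ fun ν hν => ?_
    exact (le_iSup₂_of_le ν (f.support.min'_le ν hν) le_rfl :
      eigenspace T ν ≤ ⨆ ν ∈ Set.Ici (f.support.min' hne), eigenspace T ν) (hf ν)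
  choose μ hμs hμ hvμ using h1
  obtain ⟨i₀, -, hi₀⟩ := Finset.exists_min_image Finset.univ μ ⟨0, Finset.mem_univ _⟩
  refine ⟨μ i₀, hμs i₀, hμ i₀, ?_⟩
  have hmem : ∀ i, (v i : E) ∈ ⨆ ν ∈ Set.Ici (μ i₀), eigenspace T ν := fun i =>
    (biSup_mono fun ν (hν : μ i ≤ ν) => (hi₀ i (Finset.mem_univ i)).trans hν :
      (⨆ ν ∈ Set.Ici (μ i), eigenspace T ν) ≤ ⨆ ν ∈ Set.Ici (μ i₀), eigenspace T ν) (hvμ i)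
  have hv' : LinearIndependent ℝ (fun i => (v i : E)) :=
    hv.map' (Submodule.subtype _) (Submodule.ker_subtype _)
  have hw : LinearIndependent ℝ
      (fun i => (⟨v i, hmem i⟩ : ↥(⨆ ν ∈ Set.Ici (μ i₀), eigenspace T ν))) :=
    LinearIndependent.of_comp (Submodule.subtype _) hv'
  refine lt_of_lt_of_le ?_ (Module.le_rank_iff.2 ⟨_, hw⟩)
  exact_mod_cast Nat.lt_succ_self k

variable [CompleteSpace E]

/-- By the spectral theorem the eigenspaces span a dense subspace, so such an `x` lies in the
closure of the span of the eigenspaces below `t`. The inequality holds on that span and is a closed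
condition. -/
theorem inner_map_le_of_mem_orthogonal {T : E →L[ℝ] E} (hc : IsCompactOperator T)
    (hT : T.IsSymmetric) {t : ℝ} {x : E}
    (hx : x ∈ (⨆ ν ∈ Set.Ici t, eigenspace (T : Module.End ℝ E) ν)ᗮ) :
    inner ℝ (T x) x ≤ t * ‖x‖ ^ 2 := by
  set A := ⨆ ν ∈ Set.Ici t, eigenspace (T : Module.End ℝ E) ν
  set B := ⨆ ν ∈ Set.Iio t, eigenspace (T : Module.End ℝ E) ν with hB
  have hAB : B ⟂ A := isOrtho_iSup_eigenspace hT
    (Set.disjoint_left.2 fun ν h h' => not_lt_of_ge (Set.mem_Ici.1 h') (Set.mem_Iio.1 h))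
  have hsup : (⨆ ν, eigenspace (T : Module.End ℝ E) ν) ≤ A ⊔ B := by
    refine iSup_le fun ν => ?_
    rcases le_or_gt t ν with h | h
    · exact le_sup_of_le_left (le_iSup₂_of_le ν h le_rfl)
    · exact le_sup_of_le_right (le_iSup₂_of_le ν h le_rfl)
  have hbot : (A ⊔ B)ᗮ = ⊥ := by
    rw [eq_bot_iff, ← ContinuousLinearMap.orthogonalComplement_iSup_eigenspaces_eq_bot hc hT]
    exact Submodule.orthogonal_le hsup
  have hxB : x ∈ B.topologicalClosure := by
    have hcl : IsComplete (B.topologicalClosure : Set E) :=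
      B.isClosed_topologicalClosure.isComplete
    have : CompleteSpace B.topologicalClosure := completeSpace_coe_iff_isComplete.2 hcl
    obtain ⟨p, hp, q, hq, rfl⟩ :=
      B.topologicalClosure.exists_add_mem_mem_orthogonal x
    have hpA : p ∈ Aᗮ := by
      have : B.topologicalClosure ≤ Aᗮ :=
        Submodule.topologicalClosure_minimal _ hAB (Submodule.isClosed_orthogonal _)
      exact this hp
    have hqA : q ∈ Aᗮ := by simpa using Submodule.sub_mem _ hx hpA
    have hqB : q ∈ Bᗮ := Submodule.orthogonal_le B.le_topologicalClosure hq
    have hq0 : q ∈ (A ⊔ B)ᗮ := by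
      rw [← Submodule.inf_orthogonal]; exact ⟨hqA, hqB⟩
    rw [hbot, Submodule.mem_bot] at hq0
    simpa [hq0] using hp
  have hclosed : IsClosed {x : E | inner ℝ (T x) x ≤ t * ‖x‖ ^ 2} :=
    isClosed_le (by fun_prop) (by fun_prop)
  have hsub : (B : Set E) ⊆ {x : E | inner ℝ (T x) x ≤ t * ‖x‖ ^ 2} := fun y hy =>
    inner_map_le_of_mem_iSup_eigenspace hT (fun ν hν => (Set.mem_Iio.1 hν).le) hy
  exact closure_minimal hsub hclosed hxB

/-- If the spectral subspace `A` had dimension at most `k`, the projection `V → A` would kill some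
nonzero `x ∈ V`. Then `x ∈ Aᗮ` gives `t‖x‖² ≤ ⟨Tx, x⟩ ≤ s‖x‖²`, against `s < t`. -/
theorem lt_rank_iSup_eigenspace_of_le_inner {T : E →L[ℝ] E} (hc : IsCompactOperator T)
    (hT : T.IsSymmetric) {V : Submodule ℝ E} {k : ℕ} (hk : (k : Cardinal) < Module.rank ℝ V)
    {s t : ℝ} (hst : s < t) (hV : ∀ x ∈ V, t * ‖x‖ ^ 2 ≤ inner ℝ (T x) x) :
    (k : Cardinal) <
      Module.rank ℝ ↥(⨆ ν ∈ Set.Ici s, eigenspace (T : Module.End ℝ E) ν) := by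
  set A := ⨆ ν ∈ Set.Ici s, eigenspace (T : Module.End ℝ E) ν
  by_contra! hA
  have : FiniteDimensional ℝ A :=
    Module.rank_lt_aleph0_iff.1 (hA.trans_lt Cardinal.natCast_lt_aleph0)
  let P : V →ₗ[ℝ] A := (A.orthogonalProjectionOnto : E →ₗ[ℝ] A).comp V.subtype
  have hP : ¬ Function.Injective P := fun h =>
    absurd (LinearMap.rank_le_of_injective P h) (not_le.2 (hA.trans_lt hk))
  rw [← LinearMap.ker_eq_bot, Submodule.eq_bot_iff] at hP
  push Not at hP
  obtain ⟨x, hx, hx0⟩ := hP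
  have hxA : (x : E) ∈ Aᗮ := by
    rw [← Submodule.orthogonalProjectionOnto_eq_zero_iff]
    exact hx
  have h1 := inner_map_le_of_mem_orthogonal hc hT hxA
  have h2 := hV x x.2
  have h3 : 0 < ‖(x : E)‖ ^ 2 := by
    have : (x : E) ≠ 0 := fun h => hx0 (Subtype.ext h)
    positivity
  nlinarith

end CompactSymmetric

/-! ### Weyl's inequality and convergence of ordered eigenvalues -/

theorem bddAbove_posEigenvalue_set (T : L2I →L[ℝ] L2I) (k : ℕ) :
    BddAbove {μ : ℝ | 0 < μ ∧ Module.End.HasEigenvalue (T : Module.End ℝ L2I) μ ∧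
      (k : Cardinal) < Module.rank ℝ
        ↥(⨆ ν ∈ Set.Ici μ, Module.End.eigenspace (T : Module.End ℝ L2I) ν)} := by
  refine ⟨‖T‖, ?_⟩
  rintro μ ⟨hμ0, hμ, -⟩
  obtain ⟨x, hx, hx0⟩ := hμ.exists_hasEigenvector
  have h := T.le_opNorm x
  have hTx : T x = μ • x := Module.End.mem_eigenspace_iff.1 hx
  rw [hTx, norm_smul, Real.norm_eq_abs, abs_of_pos hμ0] at h
  exact le_of_mul_le_mul_right h (norm_pos_iff.2 hx0)

theorem posEigenvalue_nonneg (T : L2I →L[ℝ] L2I) (k : ℕ) : 0 ≤ posEigenvalue T k :=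
  Real.sSup_nonneg fun _ h => h.1.le

/-- One half of the Courant–Fischer principle. For `t ≤ 0` it holds because the list is continued by
zeros. -/
theorem le_posEigenvalue_of_le_inner {T : L2I →L[ℝ] L2I} (hc : IsCompactOperator T)
    (hT : T.IsSymmetric) {V : Submodule ℝ L2I} {k : ℕ} (hk : (k : Cardinal) < Module.rank ℝ V)
    {t : ℝ} (hV : ∀ x ∈ V, t * ‖x‖ ^ 2 ≤ inner ℝ (T x) x) : t ≤ posEigenvalue T k := by
  refine le_of_forall_lt fun s hs => ?_
  rcases le_or_gt t 0 with ht | ht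
  · exact (hs.trans_le ht).trans_le (posEigenvalue_nonneg T k)
  -- A level strictly below `t` is what the rank bound needs; taking it above 0 makes the eigenvalue
  -- found positive.
  obtain ⟨r, hsr, hrt⟩ := exists_between (max_lt hs ht)
  obtain ⟨μ, hrμ, hμ, hkμ⟩ :=
    exists_hasEigenvalue_of_lt_rank (lt_rank_iSup_eigenspace_of_le_inner hc hT hk hrt hV)
  refine ((le_max_left s 0).trans_lt hsr).trans_le (hrμ.trans ?_)
  exact le_csSup (bddAbove_posEigenvalue_set T k)
    ⟨((le_max_right s 0).trans_lt hsr).trans_le hrμ, hμ, hkμ⟩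

/-- The span of the eigenspaces of `S` at levels `≥ μ` is a test space for `T`: on it `⟨Tx, x⟩ ≥ (μ
- ‖S - T‖)‖x‖²`. -/
theorem posEigenvalue_le_add_norm_sub {S T : L2I →L[ℝ] L2I} (hS : S.IsSymmetric)
    (hc : IsCompactOperator T) (hT : T.IsSymmetric) (k : ℕ) :
    posEigenvalue S k ≤ posEigenvalue T k + ‖S - T‖ := by
  refine Real.sSup_le ?_ (add_nonneg (posEigenvalue_nonneg T k) (norm_nonneg _))
  rintro μ ⟨-, -, hk⟩
  rw [← sub_le_iff_le_add]
  refine le_posEigenvalue_of_le_inner hc hT hk fun x hx => ?_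
  have h1 : μ * ‖x‖ ^ 2 ≤ inner ℝ (S x) x :=
    le_inner_map_of_mem_iSup_eigenspace hS (fun ν hν => hν) hx
  have h2 : inner ℝ ((S - T) x) x ≤ ‖S - T‖ * ‖x‖ ^ 2 := by
    refine (real_inner_le_norm _ _).trans ?_
    rw [sq, ← mul_assoc]
    exact mul_le_mul_of_nonneg_right ((S - T).le_opNorm x) (norm_nonneg _)
  rw [sub_apply, inner_sub_left] at h2
  rw [sub_mul]
  linarith

theorem tendsto_posEigenvalue {T : ℕ → L2I →L[ℝ] L2I} {S : L2I →L[ℝ] L2I}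
    (hTc : ∀ n, IsCompactOperator (T n)) (hTs : ∀ n, (T n).IsSymmetric)
    (hSc : IsCompactOperator S) (hSs : S.IsSymmetric)
    (h : Tendsto (fun n => ‖T n - S‖) atTop (𝓝 0)) (k : ℕ) :
    Tendsto (fun n => posEigenvalue (T n) k) atTop (𝓝 (posEigenvalue S k)) := by
  rw [tendsto_iff_dist_tendsto_zero]
  refine squeeze_zero (fun _ => dist_nonneg) (fun n => ?_) h
  have h1 := posEigenvalue_le_add_norm_sub (hTs n) hSc hSs k
  have h2 := posEigenvalue_le_add_norm_sub hSs (hTc n) (hTs n) k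
  rw [norm_sub_rev] at h2
  rw [Real.dist_eq, abs_le]
  constructor <;> linarith

theorem eigenspace_neg (T : L2I →L[ℝ] L2I) (ν : ℝ) :
    Module.End.eigenspace ((-T : L2I →L[ℝ] L2I) : Module.End ℝ L2I) ν =
      Module.End.eigenspace (T : Module.End ℝ L2I) (-ν) := by
  ext x
  simp only [Module.End.mem_eigenspace_iff, ContinuousLinearMap.coe_coe,
    neg_apply, neg_smul]
  exact neg_eq_iff_eq_neg

theorem negEigenvalue_eq_neg_posEigenvalue_neg (T : L2I →L[ℝ] L2I) (k : ℕ) :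
    negEigenvalue T k = -posEigenvalue (-T) k := by
  -- On `ℝ`, `sInf s` is by definition `-sSup (-s)`, so the empty set with its default value 0 needs
  -- no separate case.
  rw [negEigenvalue, Real.sInf_def, posEigenvalue]
  congr 2
  ext μ
  have hsup : (⨆ ν ∈ Set.Ici μ,
      Module.End.eigenspace ((-T : L2I →L[ℝ] L2I) : Module.End ℝ L2I) ν) =
      ⨆ ν ∈ Set.Iic (-μ), Module.End.eigenspace (T : Module.End ℝ L2I) ν := by
    simp only [eigenspace_neg]
    apply le_antisymm
    · exact iSup₂_le fun ν hν => le_iSup₂_of_le (-ν) (Set.mem_Iic.2 (neg_le_neg (Set.mem_Ici.1 hν))) le_rfl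
    · refine iSup₂_le fun ν hν => le_iSup₂_of_le (-ν) (Set.mem_Ici.2 (le_neg.1 (Set.mem_Iic.1 hν))) ?_
      rw [neg_neg]
  rw [Set.mem_neg, Set.mem_ofPred_eq, Set.mem_ofPred_eq, hsup, Module.End.hasEigenvalue_iff,
    Module.End.hasEigenvalue_iff, eigenspace_neg, neg_lt_zero]

theorem spectraConverge_of_tendsto_norm_sub {T : ℕ → L2I →L[ℝ] L2I} {S : L2I →L[ℝ] L2I}
    (hTc : ∀ n, IsCompactOperator (T n)) (hTs : ∀ n, (T n).IsSymmetric)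
    (hSc : IsCompactOperator S) (hSs : S.IsSymmetric)
    (h : Tendsto (fun n => ‖T n - S‖) atTop (𝓝 0)) : SpectraConverge T S := by
  refine fun k => ⟨tendsto_posEigenvalue hTc hTs hSc hSs h k, ?_⟩
  simp only [negEigenvalue_eq_neg_posEigenvalue_neg]
  have hneg : ∀ {R : L2I →L[ℝ] L2I}, R.IsSymmetric → (-R).IsSymmetric := fun {R} hR x y => by
    have := hR x y
    simpa using this
  refine (tendsto_posEigenvalue (fun n => (hTc n).neg) (fun n => hneg (hTs n)) hSc.neg (hneg hSs)
    ?_ k).neg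
  simpa only [neg_sub_neg, norm_sub_rev] using h

/-! ### Kernel operators are symmetric and Hilbert–Schmidt, hence compact -/

theorem isCompactOperator_of_summable_norm_sq {E ι : Type*} [NormedAddCommGroup E]
    [InnerProductSpace ℝ E] [CompleteSpace E] (b : HilbertBasis ι ℝ E) {T : E →L[ℝ] E}
    (hT : T.IsSymmetric) (hsum : Summable fun i => ‖T (b i)‖ ^ 2) : IsCompactOperator T := by
  classical
  -- By symmetry `F s` is `T` followed by projection onto the span of the `b i`, `i ∈ s`. Parseval
  -- and Cauchy–Schwarz bound `‖F s - T‖²` by the tail of the series.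
  let F : Finset ι → E →L[ℝ] E := fun s =>
    ∑ i ∈ s, (innerSL ℝ (T (b i))).smulRight (b i)
  have hF : ∀ s, IsCompactOperator (F s) := fun s => by
    have : F s ∈ compactOperator (RingHom.id ℝ) E E := by
      refine Submodule.sum_mem _ fun i _ => ?_
      have h1 : IsCompactOperator
          ((ContinuousLinearMap.toSpanSingleton ℝ (b i)).comp (innerSL ℝ (T (b i)))) :=
        (isCompactOperator_of_locallyCompactSpace_rng
          (ContinuousLinearMap.toSpanSingleton ℝ (b i))).comp_clm (innerSL ℝ (T (b i)))
      exact h1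
    exact this
  refine isCompactOperator_of_tendsto (l := atTop) (F := F) ?_ (Eventually.of_forall hF)
  rw [tendsto_iff_norm_sub_tendsto_zero]
  have htail : Tendsto (fun s : Finset ι =>
      √(∑' i, ‖T (b i)‖ ^ 2 - ∑ i ∈ s, ‖T (b i)‖ ^ 2)) atTop (𝓝 0) := by
    have := (hsum.hasSum.const_sub (∑' i, ‖T (b i)‖ ^ 2)).sqrt
    rwa [sub_self, Real.sqrt_zero] at this
  refine squeeze_zero (fun _ => norm_nonneg _) (fun s => ?_) htail
  refine ContinuousLinearMap.opNorm_le_bound _ (Real.sqrt_nonneg _) fun x => ?_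
  have hcoef : ∀ i, inner ℝ (b i) ((F s - T) x) =
      if i ∈ s then 0 else - inner ℝ (T (b i)) x := fun i => by
    have h1 : inner ℝ (b i) (F s x) = ∑ j ∈ s, inner ℝ (T (b j)) x * inner ℝ (b i) (b j) := by
      simp [F, sum_apply, inner_sum, inner_smul_right]
    have h2 : inner ℝ (b i) (T x) = inner ℝ (T (b i)) x := (hT (b i) x).symm
    rw [sub_apply, inner_sub_right, h1, h2]
    simp only [orthonormal_iff_ite.1 b.orthonormal, mul_ite, mul_one, mul_zero,
      Finset.sum_ite_eq]
    split_ifs <;> simp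
  have hpars := b.hasSum_inner_mul_inner ((F s - T) x) ((F s - T) x)
  have htot : HasSum (fun i => ‖x‖ ^ 2 * (‖T (b i)‖ ^ 2 - if i ∈ s then ‖T (b i)‖ ^ 2 else 0))
      (‖x‖ ^ 2 * (∑' i, ‖T (b i)‖ ^ 2 - ∑ i ∈ s, ‖T (b i)‖ ^ 2)) := by
    refine (hsum.hasSum.sub ?_).mul_left _
    have : HasSum (fun i => if i ∈ s then ‖T (b i)‖ ^ 2 else 0)
        (∑ i ∈ s, if i ∈ s then ‖T (b i)‖ ^ 2 else 0) :=
      hasSum_sum_of_ne_finset_zero fun i hi => if_neg hi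
    rwa [Finset.sum_congr rfl fun i hi => if_pos hi] at this
  have hle := hasSum_le (fun i => ?_) hpars htot
  · rw [real_inner_self_eq_norm_sq] at hle
    have := Real.sqrt_le_sqrt hle
    rwa [Real.sqrt_sq (norm_nonneg _), Real.sqrt_mul (sq_nonneg _), Real.sqrt_sq (norm_nonneg _),
      mul_comm] at this
  · rw [real_inner_comm, hcoef]
    split_ifs
    · simp
    · have := abs_real_inner_le_norm (T (b i)) x
      have h2 := mul_self_le_mul_self (abs_nonneg _) this
      rw [abs_mul_abs_self] at h2
      nlinarith

namespace Graphon

theorem inner_kernelOp (V : Graphon) (f g : L2I) :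
    inner ℝ (V.kernelOp f) g = ∫ x, ∫ y, V.toFun (x, y) * f y * g x := by
  rw [L2.inner_def]
  refine integral_congr_ae ?_
  filter_upwards [V.kernelOp_ae_eq f] with x hx
  rw [hx, integral_mul_const]
  exact mul_comm _ _

theorem integrable_kernel_mul_mul (V : Graphon) (f g : L2I) :
    Integrable (fun p : I × I => V.toFun p * f p.2 * g p.1) := by
  have hf : Integrable (f : I → ℝ) := (Lp.memLp f).integrable (by norm_num)
  have hg : Integrable (g : I → ℝ) := (Lp.memLp g).integrable (by norm_num)
  have h := (hg.mul_prod hf).bdd_mul (c := 1) V.measurable'.aestronglyMeasurable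
    (Eventually.of_forall fun p => by
      rw [Real.norm_eq_abs, abs_of_nonneg (V.mem_Icc' _).1]; exact (V.mem_Icc' _).2)
  refine h.congr (Eventually.of_forall fun p => ?_)
  change V.toFun p * (g p.1 * f p.2) = _
  ring

theorem inner_kernelOp_eq_integral_prod (V : Graphon) (f g : L2I) :
    inner ℝ (V.kernelOp f) g = ∫ p : I × I, V.toFun p * f p.2 * g p.1 := by
  rw [inner_kernelOp, Measure.volume_eq_prod, integral_prod _ (V.integrable_kernel_mul_mul f g)]

theorem isSymmetric_kernelOp (V : Graphon) : V.kernelOp.IsSymmetric := by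
  intro f g
  change inner ℝ (V.kernelOp f) g = inner ℝ f (V.kernelOp g)
  rw [real_inner_comm (V.kernelOp g), inner_kernelOp_eq_integral_prod, inner_kernelOp_eq_integral_prod,
    Measure.volume_eq_prod, ← integral_prod_swap]
  refine integral_congr_ae (Eventually.of_forall fun p => ?_)
  change V.toFun (p.2, p.1) * f p.1 * g p.2 = V.toFun (p.1, p.2) * g p.2 * f p.1
  rw [V.symm', mul_right_comm]

theorem memLp_section (V : Graphon) (x : I) :
    MemLp (fun y => V.toFun (x, y)) 2 (volume : Measure I) :=
  MemLp.of_bound (V.measurable'.comp measurable_prodMk_left).aestronglyMeasurable 1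
    (Eventually.of_forall fun y => by
      rw [Real.norm_eq_abs, abs_of_nonneg (V.mem_Icc' _).1]; exact (V.mem_Icc' _).2)

/-- The section `V(x, ·)` of a graphon as an element of `L²([0,1])`. -/
noncomputable def sectionLp (V : Graphon) (x : I) : L2I :=
  (V.memLp_section x).toLp _

theorem norm_sectionLp_le (V : Graphon) (x : I) : ‖V.sectionLp x‖ ≤ 1 := by
  refine (Lp.norm_le_of_ae_bound zero_le_one ?_).trans ?_
  · filter_upwards [(V.memLp_section x).coeFn_toLp] with y hy
    rw [sectionLp, hy, Real.norm_eq_abs, abs_of_nonneg (V.mem_Icc' _).1]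
    exact (V.mem_Icc' _).2
  · simp [measureUnivNNReal]

theorem kernelOp_ae_eq_inner (V : Graphon) (f : L2I) :
    (V.kernelOp f : I → ℝ) =ᵐ[volume] fun x => inner ℝ f (V.sectionLp x) := by
  filter_upwards [V.kernelOp_ae_eq f] with x hx
  rw [hx, L2.inner_def]
  refine integral_congr_ae ?_
  filter_upwards [(V.memLp_section x).coeFn_toLp] with y hy
  rw [sectionLp, hy]
  rfl

/-- For almost every `x` the values at `x` are the coefficients `⟨v i, V(x,·)⟩`, so Bessel bounds
the sum of their squares by `‖V(x,·)‖² ≤ 1`; then integrate over `x`. -/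
theorem sum_norm_sq_kernelOp_le {ι : Type*} (V : Graphon) {v : ι → L2I} (hv : Orthonormal ℝ v)
    (s : Finset ι) : ∑ i ∈ s, ‖V.kernelOp (v i)‖ ^ 2 ≤ 1 := by
  have hint : ∀ h : L2I, Integrable (fun x => (h x : ℝ) * h x) := fun h =>
    L2.integrable_inner (𝕜 := ℝ) h h
  have h1 : ∀ i, ‖V.kernelOp (v i)‖ ^ 2 = ∫ x, V.kernelOp (v i) x * V.kernelOp (v i) x := fun i => by
    rw [← real_inner_self_eq_norm_sq, L2.inner_def]
    rfl
  simp only [h1]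
  rw [← integral_finsetSum _ fun i _ => hint _]
  have h2 : ∀ᵐ x : I, ∀ i ∈ s, V.kernelOp (v i) x = inner ℝ (v i) (V.sectionLp x) :=
    (ae_ball_iff s.countable_toSet).2 fun i _ => V.kernelOp_ae_eq_inner (v i)
  calc ∫ x, ∑ i ∈ s, V.kernelOp (v i) x * V.kernelOp (v i) x ≤ ∫ _ : I, (1 : ℝ) := by
        refine integral_mono_ae (integrable_finsetSum _ fun i _ => hint _)
          (integrable_const _) ?_
        filter_upwards [h2] with x hx
        have h3 := hv.sum_inner_products_le (V.sectionLp x) (s := s)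
        have h4 : ‖V.sectionLp x‖ ^ 2 ≤ 1 := pow_le_one₀ (norm_nonneg _) (V.norm_sectionLp_le x)
        refine le_trans (le_of_eq ?_) (h3.trans h4)
        refine Finset.sum_congr rfl fun i hi => ?_
        rw [hx i hi, Real.norm_eq_abs, sq_abs, sq]
    _ = 1 := by simp

theorem isCompactOperator_kernelOp (V : Graphon) : IsCompactOperator V.kernelOp := by
  obtain ⟨w, b, -⟩ := exists_hilbertBasis ℝ L2I
  exact isCompactOperator_of_summable_norm_sq b V.isSymmetric_kernelOp
    (summable_of_sum_le (fun _ => sq_nonneg _) (V.sum_norm_sq_kernelOp_le b.orthonormal))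

end Graphon

/-! ### The cut norm controls the operator norm -/

theorem abs_integral_le_of_abs_le {α : Type*} [MeasurableSpace α] {μ : Measure α}
    [IsProbabilityMeasure μ] {F : α → ℝ} {C : ℝ} (h : ∀ x, |F x| ≤ C) : |∫ x, F x ∂μ| ≤ C := by
  have := norm_integral_le_of_norm_le_const (μ := μ) (f := F) (C := C) (Eventually.of_forall h)
  simpa using this

theorem abs_mul_unitInterval_le {a C : ℝ} (ha : |a| ≤ C) (x : I) : |a * x| ≤ C := by
  rw [abs_mul, abs_of_nonneg x.2.1]
  exact (mul_le_of_le_one_right (abs_nonneg a) x.2.2).trans ha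

theorem abs_integral_le_cutNorm {D : I × I → ℝ} {C : ℝ} (hD : ∀ p, |D p| ≤ C) {f g : I → I}
    (hf : Measurable f) (hg : Measurable g) :
    |∫ p : I × I, D p * (f p.1 : ℝ) * (g p.2 : ℝ)| ≤ cutNorm D := by
  refine le_csSup ⟨C, ?_⟩ ⟨f, g, hf, hg, rfl⟩
  rintro r ⟨f, g, -, -, rfl⟩
  exact abs_integral_le_of_abs_le fun p =>
    abs_mul_unitInterval_le (abs_mul_unitInterval_le (hD p) _) _

theorem cutNorm_nonneg (D : I × I → ℝ) : 0 ≤ cutNorm D := by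
  refine Real.sSup_nonneg ?_
  rintro r ⟨f, g, -, -, rfl⟩
  exact abs_nonneg _

theorem cutNorm_le {D : I × I → ℝ} {C : ℝ}
    (h : ∀ f g : I → I, Measurable f → Measurable g →
      |∫ p : I × I, D p * (f p.1 : ℝ) * (g p.2 : ℝ)| ≤ C) : cutNorm D ≤ C := by
  refine csSup_le ⟨_, fun _ => 0, fun _ => 0, measurable_const, measurable_const, rfl⟩ ?_
  rintro r ⟨f, g, hf, hg, rfl⟩
  exact h f g hf hg

theorem integrable_mul_prod_of_abs_le_one {D : I × I → ℝ} (hDm : Measurable D)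
    (hD : ∀ p, |D p| ≤ 1) {u v : I → ℝ} (hu : Integrable u) (hv : Integrable v) :
    Integrable (fun p : I × I => D p * u p.1 * v p.2) := by
  refine ((hu.mul_prod hv).bdd_mul (c := 1) hDm.aestronglyMeasurable
    (Eventually.of_forall hD)).congr (Eventually.of_forall fun p => ?_)
  exact (mul_assoc _ _ _).symm

theorem abs_integral_mul_prod_le {D : I × I → ℝ} (hD : ∀ p, |D p| ≤ 1) {u v : I → ℝ}
    (hu : Integrable u) (hv : Integrable v) :
    |∫ p : I × I, D p * u p.1 * v p.2| ≤ (∫ x, |u x|) * ∫ y, |v y| := by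
  rw [← integral_prod_mul (fun x => |u x|) (fun y => |v y|), ← Real.norm_eq_abs]
  refine norm_integral_le_of_norm_le (hu.abs.mul_prod hv.abs) (Eventually.of_forall fun p => ?_)
  rw [Real.norm_eq_abs, abs_mul, abs_mul, mul_assoc]
  exact mul_le_of_le_one_left (by positivity) (hD p)

theorem abs_integral_mul_prod_le_of_abs_le {D : I × I → ℝ} (hDm : Measurable D)
    (hD : ∀ p, |D p| ≤ 1) {u v : I → ℝ} (hu : Measurable u) (hv : Measurable v) {M : ℝ}
    (hM : 0 < M) (huM : ∀ x, |u x| ≤ M) (hvM : ∀ x, |v x| ≤ M) :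
    |∫ p : I × I, D p * u p.1 * v p.2| ≤ 4 * M ^ 2 * cutNorm D := by
  -- `P w` and `P (-w)` are the positive and negative parts of `w / M`. Splitting both `u` and `v`
  -- gives four admissible pairings, whence the constant `4M²`.
  let P : (I → ℝ) → I → I := fun w x => Set.projIcc 0 1 zero_le_one (w x / M)
  have hP : ∀ {w : I → ℝ}, Measurable w → Measurable (P w) := fun hw =>
    continuous_projIcc.measurable.comp (hw.div_const M)
  have hdec : ∀ w : I → ℝ, (∀ x, |w x| ≤ M) → ∀ x,
      w x = M * ((P w x : ℝ) - (P (-w) x : ℝ)) := fun w hw x => by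
    have h1 : |w x / M| ≤ 1 := by
      rw [abs_div, abs_of_pos hM]; exact (div_le_one hM).2 (hw x)
    have h2 : w x = M * (w x / M) := by field_simp
    rw [abs_le] at h1
    have h3 : ((P w x : ℝ) - (P (-w) x : ℝ)) = w x / M := by
      simp only [P, Set.coe_projIcc, Pi.neg_apply, neg_div]
      rw [min_eq_right h1.2, min_eq_right (by linarith)]
      rcases le_total 0 (w x / M) with h | h
      · rw [max_eq_right h, max_eq_left (by linarith), sub_zero]
      · rw [max_eq_left h, max_eq_right (by linarith)]; ring
    rw [h3, ← h2]
  have hint : ∀ f g : I → I, Measurable f → Measurable g →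
      Integrable (fun p : I × I => D p * (f p.1 : ℝ) * (g p.2 : ℝ)) := fun f g hf hg => by
    refine Integrable.of_bound (C := 1) (by fun_prop) (Eventually.of_forall fun p => ?_)
    exact abs_mul_unitInterval_le (abs_mul_unitInterval_le (hD p) _) _
  have hu' := hP hu
  have hu'' := hP hu.neg
  have hv' := hP hv
  have hv'' := hP hv.neg
  have key : ∫ p : I × I, D p * u p.1 * v p.2 = M ^ 2 *
      ((∫ p : I × I, D p * (P u p.1 : ℝ) * (P v p.2 : ℝ))
        - (∫ p : I × I, D p * (P u p.1 : ℝ) * (P (-v) p.2 : ℝ))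
        - (∫ p : I × I, D p * (P (-u) p.1 : ℝ) * (P v p.2 : ℝ))
        + (∫ p : I × I, D p * (P (-u) p.1 : ℝ) * (P (-v) p.2 : ℝ))) := by
    have i1 := (hint _ _ hu' hv').sub (hint _ _ hu' hv'')
    have i2 := i1.sub (hint _ _ hu'' hv')
    rw [← integral_sub' (hint _ _ hu' hv') (hint _ _ hu' hv''),
      ← integral_sub' i1 (hint _ _ hu'' hv'), ← integral_add' i2 (hint _ _ hu'' hv''),
      ← integral_const_mul]
    refine integral_congr_ae (Eventually.of_forall fun p => ?_)
    change D p * u p.1 * v p.2 = _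
    rw [hdec u huM p.1, hdec v hvM p.2]
    simp only [Pi.sub_apply, Pi.add_apply]
    ring
  have h1 := abs_le.1 (abs_integral_le_cutNorm hD hu' hv')
  have h2 := abs_le.1 (abs_integral_le_cutNorm hD hu' hv'')
  have h3 := abs_le.1 (abs_integral_le_cutNorm hD hu'' hv')
  have h4 := abs_le.1 (abs_integral_le_cutNorm hD hu'' hv'')
  rw [key, abs_mul, abs_of_nonneg (sq_nonneg M), mul_comm 4, mul_assoc]
  refine mul_le_mul_of_nonneg_left ?_ (sq_nonneg M)
  rw [abs_le]
  constructor <;> linarith [h1.1, h1.2, h2.1, h2.2, h3.1, h3.2, h4.1, h4.2]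

/-- The clamping error vanishes unless `|a| > M`, and then it is `|a| - M ≤ a² / M`. Thus an `L²`
bound controls the `L¹` size of the tail. -/
theorem abs_sub_clamp_le {M : ℝ} (hM : 0 < M) (a : ℝ) :
    |a - max (-M) (min a M)| ≤ a ^ 2 / M ∧ |max (-M) (min a M)| ≤ M ∧
      |max (-M) (min a M)| ≤ |a| := by
  rw [le_div_iff₀ hM]
  rcases le_total a M with h | h
  · rw [min_eq_left h]
    rcases le_total (-M) a with h' | h'
    · rw [max_eq_right h', sub_self, abs_zero, zero_mul]
      exact ⟨sq_nonneg a, abs_le.2 ⟨h', h⟩, le_rfl⟩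
    · rw [max_eq_left h', abs_neg, abs_of_pos hM, abs_of_nonpos (by linarith : a - -M ≤ 0),
        abs_of_nonpos (by linarith : a ≤ 0)]
      exact ⟨by nlinarith, le_rfl, by linarith⟩
  · rw [min_eq_right h, max_eq_right (by linarith), abs_of_pos hM,
      abs_of_nonneg (by linarith : 0 ≤ a - M), abs_of_nonneg (by linarith : 0 ≤ a)]
    exact ⟨by nlinarith, le_rfl, h⟩

theorem integral_abs_le_one_of_integral_sq_le_one {u : I → ℝ} (hu : MemLp u 2)
    (hu1 : ∫ x, u x ^ 2 ≤ 1) : ∫ x, |u x| ≤ 1 := by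
  have h : ∫ x, |u x| ≤ ∫ x, (1 + u x ^ 2) / 2 := by
    refine integral_mono (hu.integrable (by norm_num)).abs
      (((integrable_const _).add hu.integrable_sq).div_const 2) fun x => ?_
    change |u x| ≤ (1 + u x ^ 2) / 2
    nlinarith [sq_abs (u x), sq_nonneg (|u x| - 1)]
  rw [integral_div, integral_add (integrable_const _) hu.integrable_sq] at h
  simp only [integral_const, probReal_univ, smul_eq_mul, mul_one] at h
  linarith

theorem abs_integral_mul_prod_le_cutNorm_add {D : I × I → ℝ} (hDm : Measurable D)
    (hD : ∀ p, |D p| ≤ 1) {u v : I → ℝ} (hum : Measurable u) (hvm : Measurable v)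
    (hu : MemLp u 2) (hv : MemLp v 2) (hu1 : ∫ x, u x ^ 2 ≤ 1) (hv1 : ∫ x, v x ^ 2 ≤ 1)
    {M : ℝ} (hM : 0 < M) :
    |∫ p : I × I, D p * u p.1 * v p.2| ≤ 4 * M ^ 2 * cutNorm D + 2 / M := by
  let c : (I → ℝ) → I → ℝ := fun w x => max (-M) (min (w x) M)
  have hcm : ∀ {w : I → ℝ}, Measurable w → Measurable (c w) := fun hw =>
    measurable_const.max (hw.min measurable_const)
  have hci : ∀ {w : I → ℝ}, Measurable w → Integrable (c w) := fun hw =>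
    Integrable.of_bound (hcm hw).aestronglyMeasurable M
      (Eventually.of_forall fun x => (abs_sub_clamp_le hM _).2.1)
  have htail : ∀ {w : I → ℝ}, Measurable w → MemLp w 2 → ∫ x, w x ^ 2 ≤ 1 →
      ∫ x, |w x - c w x| ≤ 1 / M := fun {w} hwm hw hw1 => by
    have hwi : Integrable w := hw.integrable (by norm_num)
    refine (integral_mono (hwi.sub (hci hwm)).abs (hw.integrable_sq.div_const M)
      fun x => (abs_sub_clamp_le hM (w x)).1).trans ?_
    rw [integral_div]
    exact div_le_div_of_nonneg_right hw1 hM.le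
  have hui : Integrable u := hu.integrable (by norm_num)
  have hvi : Integrable v := hv.integrable (by norm_num)
  have hcu : ∫ x, |c u x| ≤ 1 :=
    (integral_mono (hci hum).abs hui.abs fun x => (abs_sub_clamp_le hM (u x)).2.2).trans
      (integral_abs_le_one_of_integral_sq_le_one hu hu1)
  have hv1' : ∫ x, |v x| ≤ 1 := integral_abs_le_one_of_integral_sq_le_one hv hv1
  have hi1 := integrable_mul_prod_of_abs_le_one hDm hD (hci hum) (hci hvm)
  have hi2 := integrable_mul_prod_of_abs_le_one hDm hD (hui.sub (hci hum)) hvi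
  have hi3 := integrable_mul_prod_of_abs_le_one hDm hD (hci hum) (hvi.sub (hci hvm))
  -- The bounded parts are paired through the cut norm; each of the two tail terms costs `1/M`,
  -- since the other factor has `L¹` norm at most 1.
  have key : ∫ p : I × I, D p * u p.1 * v p.2 =
      (∫ p : I × I, D p * c u p.1 * c v p.2) + (∫ p : I × I, D p * (u - c u) p.1 * v p.2) +
        ∫ p : I × I, D p * c u p.1 * (v - c v) p.2 := by
    rw [← integral_add' hi1 hi2, ← integral_add' (hi1.add hi2) hi3]
    refine integral_congr_ae (Eventually.of_forall fun p => ?_)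
    simp only [Pi.sub_apply, Pi.add_apply]
    ring
  have h1 := abs_integral_mul_prod_le_of_abs_le hDm hD (hcm hum) (hcm hvm) hM
    (fun x => (abs_sub_clamp_le hM _).2.1) (fun x => (abs_sub_clamp_le hM _).2.1)
  have h2 : |∫ p : I × I, D p * (u - c u) p.1 * v p.2| ≤ 1 / M := by
    refine (abs_integral_mul_prod_le hD (hui.sub (hci hum)) hvi).trans ?_
    exact (mul_le_of_le_one_right (integral_nonneg fun _ => abs_nonneg _) hv1').trans
      (htail hum hu hu1)
  have h3 : |∫ p : I × I, D p * c u p.1 * (v - c v) p.2| ≤ 1 / M := by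
    refine (abs_integral_mul_prod_le hD (hci hum) (hvi.sub (hci hvm))).trans ?_
    exact (mul_le_of_le_one_left (integral_nonneg fun _ => abs_nonneg _) hcu).trans
      (htail hvm hv hv1)
  rw [key]
  refine (abs_add_three _ _ _).trans ?_
  have : 2 / M = 1 / M + 1 / M := by ring
  linarith

theorem opNorm_le_of_inner_le {E : Type*} [NormedAddCommGroup E] [InnerProductSpace ℝ E]
    {T : E →L[ℝ] E} {C : ℝ} (hC : 0 ≤ C)
    (h : ∀ x y, ‖x‖ = 1 → ‖y‖ = 1 → inner ℝ (T x) y ≤ C) : ‖T‖ ≤ C := by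
  refine T.opNorm_le_of_unit_norm hC fun x hx => ?_
  by_cases hTx : T x = 0
  · rwa [hTx, norm_zero]
  have hn : ‖T x‖ ≠ 0 := norm_ne_zero_iff.2 hTx
  have h1 := h x (‖T x‖⁻¹ • T x) hx
    (by rw [norm_smul, norm_inv, norm_norm, inv_mul_cancel₀ hn])
  rwa [inner_smul_right, real_inner_self_eq_norm_sq, sq, inv_mul_cancel_left₀ hn] at h1

namespace Graphon

theorem abs_sub_le_one (V V' : Graphon) (p : I × I) : |V.toFun p - V'.toFun p| ≤ 1 := by
  have h := V.mem_Icc' p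
  have h' := V'.mem_Icc' p
  rw [abs_le]
  constructor <;> linarith [h.1, h.2, h'.1, h'.2]

theorem norm_kernelOp_sub_le (V V' : Graphon) {M : ℝ} (hM : 0 < M) :
    ‖V.kernelOp - V'.kernelOp‖ ≤
      4 * M ^ 2 * cutNorm (fun p => V.toFun p - V'.toFun p) + 2 / M := by
  have hc := cutNorm_nonneg (fun p => V.toFun p - V'.toFun p)
  refine opNorm_le_of_inner_le (by positivity) fun f g hf hg => ?_
  have hsq : ∀ h : L2I, ‖h‖ = 1 → ∫ x, (h x) ^ 2 ≤ 1 := fun h hh => by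
    have h1 : inner ℝ h h = ∫ x, (h x) ^ 2 := by
      rw [L2.inner_def]
      refine integral_congr_ae (Eventually.of_forall fun x => ?_)
      exact (sq (h x)).symm
    rw [← h1, real_inner_self_eq_norm_sq, hh, one_pow]
  rw [sub_apply, inner_sub_left, inner_kernelOp_eq_integral_prod,
    inner_kernelOp_eq_integral_prod,
    ← integral_sub (V.integrable_kernel_mul_mul f g) (V'.integrable_kernel_mul_mul f g)]
  have h := abs_integral_mul_prod_le_cutNorm_add
    (D := fun p => V.toFun p - V'.toFun p) (V.measurable'.sub V'.measurable') (V.abs_sub_le_one V')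
    (Lp.stronglyMeasurable g).measurable (Lp.stronglyMeasurable f).measurable
    (Lp.memLp g) (Lp.memLp f) (hsq g hg) (hsq f hf) hM
  refine le_trans (le_of_eq ?_) ((le_abs_self _).trans h)
  refine integral_congr_ae (Eventually.of_forall fun p => ?_)
  change V.toFun p * f p.2 * g p.1 - V'.toFun p * f p.2 * g p.1 =
    (V.toFun p - V'.toFun p) * g p.1 * f p.2
  ring

theorem tendsto_norm_kernelOp_sub {V : ℕ → Graphon} {V₀ : Graphon}
    (h : Tendsto (fun n => cutNorm (fun p => (V n).toFun p - V₀.toFun p)) atTop (𝓝 0)) :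
    Tendsto (fun n => ‖(V n).kernelOp - V₀.kernelOp‖) atTop (𝓝 0) := by
  refine tendsto_order.2 ⟨fun a ha => Eventually.of_forall fun n => ha.trans_le (norm_nonneg _),
    fun ε hε => ?_⟩
  -- Truncating at `M = 4/ε` makes the tail term `2/M = ε/2`; with `M` fixed, the cut norm term
  -- tends to 0.
  have hM : 0 < 4 / ε := by positivity
  have h1 := (h.const_mul (4 * (4 / ε) ^ 2)).add_const (2 / (4 / ε))
  have h2 : 4 * (4 / ε) ^ 2 * 0 + 2 / (4 / ε) < ε := by
    have : 2 / (4 / ε) = ε / 2 := by field_simp; norm_num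
    rw [this]; linarith
  filter_upwards [h1.eventually_lt_const h2] with n hn
  exact ((V n).norm_kernelOp_sub_le V₀ hM).trans_lt hn

theorem spectraConverge_kernelOp {V : ℕ → Graphon} {V₀ : Graphon}
    (h : Tendsto (fun n => cutNorm (fun p => (V n).toFun p - V₀.toFun p)) atTop (𝓝 0)) :
    SpectraConverge (fun n => (V n).kernelOp) V₀.kernelOp :=
  spectraConverge_of_tendsto_norm_sub (fun n => (V n).isCompactOperator_kernelOp)
    (fun n => (V n).isSymmetric_kernelOp) V₀.isCompactOperator_kernelOp V₀.isSymmetric_kernelOp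
    (tendsto_norm_kernelOp_sub h)

end Graphon

/-! ### Measure-preserving rearrangements of coordinates -/

/-- Takes `(x₁, (x₂, x₃, x₂₃), (x₁₂, x₁₃))` to the argument order of a 3-hypergraphon. -/
theorem volume_preserving_assembleVertexPair :
    MeasurePreserving (fun z : I × ((I × I × I) × (I × I)) =>
      ((z.1, z.2.1.1, z.2.1.2.1, z.2.2.1, z.2.2.2, z.2.1.2.2) : I × I × I × I × I × I))
      volume volume := by
  have hid : MeasurePreserving (id : I → I) volume volume := MeasurePreserving.id _
  have h1 : MeasurePreserving (fun u : I × (I × I) => ((u.2.1, u.2.2, u.1) : I × I × I))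
      volume volume :=
    (volume_preserving_prodAssoc (α₁ := I) (β₁ := I) (γ₁ := I)).comp
      (Measure.measurePreserving_swap (μ := (volume : Measure I))
        (ν := (volume : Measure (I × I))))
  have h2 : MeasurePreserving (fun u : (I × I) × (I × I) =>
      ((u.1.1, u.2.1, u.2.2, u.1.2) : I × I × I × I)) volume volume :=
    (hid.prod h1).comp (volume_preserving_prodAssoc (α₁ := I) (β₁ := I) (γ₁ := I × I))
  have h3 : MeasurePreserving (fun u : (I × I × I) × (I × I) =>
      ((u.1.1, u.1.2.1, u.2.1, u.2.2, u.1.2.2) : I × I × I × I × I)) volume volume :=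
    (hid.prod h2).comp (volume_preserving_prodAssoc (α₁ := I) (β₁ := I × I) (γ₁ := I × I))
  exact hid.prod h3

/-- Used with `α = x₁`, `δ = x₄`, `β = (x₂, x₃, x₂₃)`, `γ = (x₁₂, x₁₃)`, `ε = (x₂₄, x₃₄)`: it
isolates the coordinates attached to vertex 4, ready for Fubini. -/
theorem measurePreserving_regroup {α β γ δ ε : Type*} [MeasureSpace α] [MeasureSpace β]
    [MeasureSpace γ] [MeasureSpace δ] [MeasureSpace ε] [SFinite (volume : Measure α)]
    [SFinite (volume : Measure β)] [SFinite (volume : Measure γ)] [SFinite (volume : Measure δ)]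
    [SFinite (volume : Measure ε)] :
    MeasurePreserving (fun z : (α × δ) × (β × (γ × ε)) =>
      (((z.1.1, z.2.1, z.2.2.1), (z.1.2, z.2.2.2)) : (α × (β × γ)) × (δ × ε)))
      volume volume := by
  have hα : MeasurePreserving (id : α → α) volume volume := MeasurePreserving.id _
  have hδ : MeasurePreserving (id : δ → δ) volume volume := MeasurePreserving.id _
  have h1 : MeasurePreserving (fun u : β × (γ × ε) => (((u.1, u.2.1), u.2.2) : (β × γ) × ε))
      volume volume :=
    MeasurePreserving.symm MeasurableEquiv.prodAssoc volume_preserving_prodAssoc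
  have hsw : MeasurePreserving (Prod.swap : δ × (β × γ) → (β × γ) × δ) volume volume :=
    Measure.measurePreserving_swap
  have hε : MeasurePreserving (id : ε → ε) volume volume := MeasurePreserving.id _
  have h2 : MeasurePreserving (fun u : δ × ((β × γ) × ε) =>
      ((u.2.1, (u.1, u.2.2)) : (β × γ) × (δ × ε))) volume volume :=
    (volume_preserving_prodAssoc (α₁ := β × γ) (β₁ := δ) (γ₁ := ε)).comp
      ((hsw.prod hε).comp
        (MeasurePreserving.symm MeasurableEquiv.prodAssoc
          (volume_preserving_prodAssoc (α₁ := δ) (β₁ := β × γ) (γ₁ := ε))))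
  have h3 : MeasurePreserving (fun z : (α × δ) × ((β × γ) × ε) =>
      ((z.1.1, z.2.1, (z.1.2, z.2.2)) : α × (β × γ) × (δ × ε))) volume volume :=
    (hα.prod h2).comp
      (volume_preserving_prodAssoc (α₁ := α) (β₁ := δ) (γ₁ := (β × γ) × ε))
  have h4 : MeasurePreserving (fun u : α × (β × γ) × (δ × ε) =>
      (((u.1, u.2.1), u.2.2) : (α × (β × γ)) × (δ × ε))) volume volume :=
    MeasurePreserving.symm MeasurableEquiv.prodAssoc volume_preserving_prodAssoc
  exact h4.comp (h3.comp (((MeasurePreserving.id _).prod h1)))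

/-! ### Admissible tests for the 2-cut norm -/

theorem abs_integral_le_cutNorm2 {U : I × I × I × I × I × I → ℝ} {C : ℝ} (hU : ∀ p, |U p| ≤ C)
    {f g h : I × I × I → I} (hf : IsCutTest f) (hg : IsCutTest g) (hh : IsCutTest h) :
    |∫ p : I × I × I × I × I × I, U p *
      ((f (p.1, p.2.1, p.2.2.2.1) : ℝ) * (g (p.2.1, p.2.2.1, p.2.2.2.2.2) : ℝ) *
        (h (p.1, p.2.2.1, p.2.2.2.2.1) : ℝ))| ≤ cutNorm2 U := by
  refine le_csSup ⟨C, ?_⟩ ⟨f, g, h, hf, hg, hh, rfl⟩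
  rintro r ⟨f, g, h, -, -, -, rfl⟩
  refine abs_integral_le_of_abs_le fun p => ?_
  obtain ⟨x₁, x₂, x₃, x₁₂, x₁₃, x₂₃⟩ := p
  have := abs_mul_unitInterval_le (abs_mul_unitInterval_le (abs_mul_unitInterval_le
    (hU (x₁, x₂, x₃, x₁₂, x₁₃, x₂₃)) (f (x₁, x₂, x₁₂))) (g (x₂, x₃, x₂₃))) (h (x₁, x₃, x₁₃))
  rwa [mul_assoc, mul_assoc, ← mul_assoc (f (x₁, x₂, x₁₂) : ℝ)] at this

theorem isCutTest_one : IsCutTest fun _ => 1 := ⟨measurable_const, fun _ _ _ => rfl⟩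

/-- The average of two points of the unit interval. -/
noncomputable def unitInterval.average (s t : I) : I :=
  ⟨((s : ℝ) + t) / 2, by have := s.2.1; have := t.2.1; positivity, by
    have := s.2.2; have := t.2.2; linarith⟩

theorem isCutTest_average {a : I → I} (ha : Measurable a) :
    IsCutTest fun q => unitInterval.average (a q.1) (a q.2.1) := by
  refine ⟨Measurable.subtype_mk (by fun_prop), fun x y _ => Subtype.ext ?_⟩
  change ((a x : ℝ) + a y) / 2 = ((a y : ℝ) + a x) / 2
  rw [add_comm]

theorem IsCutTest.mul {f g : I × I × I → I} (hf : IsCutTest f) (hg : IsCutTest g) :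
    IsCutTest fun q => f q * g q :=
  ⟨hf.1.mul hg.1, fun x y z => by change f _ * g _ = f _ * g _; rw [hf.2, hg.2]⟩

/-- Testing against a product of a function of one vertex and a function of the opposite edge is
controlled by the 2-cut norm. -/
theorem abs_integral_vertex_mul_edge_le {U : I × I × I × I × I × I → ℝ} (hUm : Measurable U)
    (hU : ∀ p, |U p| ≤ 1) {a : I → I} (ha : Measurable a) {G : I × I × I → I} (hG : IsCutTest G) :
    |∫ p : I × I × I × I × I × I, U p *
      ((a p.1 : ℝ) * (G (p.2.1, p.2.2.1, p.2.2.2.2.2) : ℝ))| ≤ 3 * cutNorm2 U := by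
  -- With `m` the average of `a` over two vertices, `a(x₁) = m(x₁,x₂) + m(x₁,x₃) - m(x₂,x₃)`. Each
  -- term is an admissible test on one pair, the last being absorbed into `G`; this is the source of
  -- the constant 3.
  let m : I × I × I → I := fun q => unitInterval.average (a q.1) (a q.2.1)
  have hm : IsCutTest m := isCutTest_average ha
  have hint : ∀ f g h : I × I × I → I, Measurable f → Measurable g → Measurable h →
      Integrable (fun p : I × I × I × I × I × I => U p *
      ((f (p.1, p.2.1, p.2.2.2.1) : ℝ) * (g (p.2.1, p.2.2.1, p.2.2.2.2.2) : ℝ) *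
        (h (p.1, p.2.2.1, p.2.2.2.2.1) : ℝ))) := fun f g h hf hg hh => by
    refine Integrable.of_bound (C := 1) (by fun_prop) (Eventually.of_forall fun p => ?_)
    have := abs_mul_unitInterval_le (abs_mul_unitInterval_le (abs_mul_unitInterval_le
      (hU p) (f (p.1, p.2.1, p.2.2.2.1))) (g (p.2.1, p.2.2.1, p.2.2.2.2.2)))
      (h (p.1, p.2.2.1, p.2.2.2.2.1))
    rwa [mul_assoc, mul_assoc, ← mul_assoc (f (p.1, p.2.1, p.2.2.2.1) : ℝ)] at this
  have h1 := abs_le.1 (abs_integral_le_cutNorm2 hU hm hG isCutTest_one)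
  have h2 := abs_le.1 (abs_integral_le_cutNorm2 hU isCutTest_one hG hm)
  have h3 := abs_le.1 (abs_integral_le_cutNorm2 hU isCutTest_one (hm.mul hG) isCutTest_one)
  have i1 := hint _ _ _ hm.1 hG.1 isCutTest_one.1
  have i2 := hint _ _ _ isCutTest_one.1 hG.1 hm.1
  have i3 := hint _ _ _ isCutTest_one.1 (hm.mul hG).1 isCutTest_one.1
  have key := integral_sub' (i1.add i2) i3
  rw [integral_add' i1 i2] at key
  have heq := Eq.trans (integral_congr_ae
    (f := fun p : I × I × I × I × I × I => U p *
      ((a p.1 : ℝ) * (G (p.2.1, p.2.2.1, p.2.2.2.2.2) : ℝ))) (Eventually.of_forall fun p => by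
        simp only [Pi.sub_apply, Pi.add_apply, m, unitInterval.average, Set.Icc.coe_mul,
          Set.Icc.coe_one]
        ring)) key
  rw [heq, abs_le]
  constructor <;> linarith [h1.1, h1.2, h2.1, h2.2, h3.1, h3.2]

/-! ### The intersection graphon is Lipschitz from the 2-cut norm to the cut norm -/

namespace Hypergraphon3

theorem abs_toFun_le_one (W : Hypergraphon3) (p : I × I × I × I × I × I) : |W.toFun p| ≤ 1 := by
  rw [abs_of_nonneg (W.mem_Icc' p).1]
  exact (W.mem_Icc' p).2

theorem abs_toFun_sub_le_one (W W' : Hypergraphon3) (p : I × I × I × I × I × I) :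
    |W.toFun p - W'.toFun p| ≤ 1 := by
  have h := W.mem_Icc' p
  have h' := W'.mem_Icc' p
  rw [abs_le]
  constructor <;> linarith [h.1, h.2, h'.1, h'.2]

theorem swap_last (W : Hypergraphon3) (a b c d e f : I) :
    W.toFun (a, b, c, d, e, f) = W.toFun (a, c, b, e, d, f) := by
  have h := W.symm' (Equiv.swap 1 2) ![a, b, c] ![![a, d, e], ![d, a, f], ![e, f, a]]
    (by intro i j; fin_cases i <;> fin_cases j <;> rfl)
  exact h

/-- The function of an edge obtained by integrating `W` against a function of the opposite
vertex. -/
noncomputable def edgeAverage (W : Hypergraphon3) (g : I → I) (b : I × I × I) : I :=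
  ⟨∫ w : I × (I × I), W.toFun (w.1, b.1, b.2.1, w.2.1, w.2.2, b.2.2) * (g w.1 : ℝ),
    integral_nonneg fun _ => mul_nonneg (W.mem_Icc' _).1 (g _).2.1,
    (le_abs_self _).trans (abs_integral_le_of_abs_le fun _ =>
      abs_mul_unitInterval_le (W.abs_toFun_le_one _) _)⟩

/-- Exchanging the two vertices of the edge exchanges, by the symmetry of `W`, the two integrated
edge coordinates, which leaves the integral unchanged. -/
theorem isCutTest_edgeAverage (W : Hypergraphon3) {g : I → I} (hg : Measurable g) :
    IsCutTest (W.edgeAverage g) := by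
  have hW := W.measurable'
  refine ⟨Measurable.subtype_mk ?_, fun x y z => Subtype.ext ?_⟩
  · have h : Measurable (fun z : (I × I × I) × (I × (I × I)) =>
        W.toFun (z.2.1, z.1.1, z.1.2.1, z.2.2.1, z.2.2.2, z.1.2.2) * (g z.2.1 : ℝ)) := by
      fun_prop
    exact (h.stronglyMeasurable.integral_prod_right').measurable
  · have hm : MeasurePreserving (fun w : I × (I × I) => (w.1, w.2.swap)) volume volume :=
      (MeasurePreserving.id (volume : Measure I)).prod
        (Measure.measurePreserving_swap (μ := (volume : Measure I)) (ν := (volume : Measure I)))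
    have he : MeasurableEmbedding (fun w : I × (I × I) => (w.1, w.2.swap)) :=
      ((MeasurableEquiv.refl I).prodCongr
        (MeasurableEquiv.prodComm (α := I) (β := I))).measurableEmbedding
    change (∫ w : I × (I × I), W.toFun (w.1, x, y, w.2.1, w.2.2, z) * (g w.1 : ℝ)) =
      ∫ w : I × (I × I), W.toFun (w.1, y, x, w.2.1, w.2.2, z) * (g w.1 : ℝ)
    rw [← hm.integral_comp he]
    refine integral_congr_ae (Eventually.of_forall fun w => ?_)
    change W.toFun (w.1, x, y, w.2.2, w.2.1, z) * _ = W.toFun (w.1, y, x, w.2.1, w.2.2, z) * _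
    rw [W.swap_last]

/-- The two factors share only `x₂, x₃, x₂₃`. Integrating out the other coordinates of `W` replaces
it and `g` by `edgeAverage`, an admissible test on the edge opposite `x₁`. -/
theorem abs_integral_glue_le {U : I × I × I × I × I × I → ℝ} (hUm : Measurable U)
    (hU : ∀ p, |U p| ≤ 1) (W : Hypergraphon3) {a g : I → I} (ha : Measurable a)
    (hg : Measurable g) :
    |∫ z : (I × I) × ((I × I × I) × ((I × I) × (I × I))),
      U (z.1.1, z.2.1.1, z.2.1.2.1, z.2.2.1.1, z.2.2.1.2, z.2.1.2.2) *
      W.toFun (z.1.2, z.2.1.1, z.2.1.2.1, z.2.2.2.1, z.2.2.2.2, z.2.1.2.2) *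
      ((a z.1.1 : ℝ) * (g z.1.2 : ℝ))| ≤ 3 * cutNorm2 U := by
  have hW := W.measurable'
  let F : (I × ((I × I × I) × (I × I))) × (I × (I × I)) → ℝ := fun y =>
    U (y.1.1, y.1.2.1.1, y.1.2.1.2.1, y.1.2.2.1, y.1.2.2.2, y.1.2.1.2.2) *
      W.toFun (y.2.1, y.1.2.1.1, y.1.2.1.2.1, y.2.2.1, y.2.2.2, y.1.2.1.2.2) *
      ((a y.1.1 : ℝ) * (g y.2.1 : ℝ))
  have hFm : Measurable F := by fun_prop
  have hFi : Integrable F := by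
    refine Integrable.of_bound (C := 1) hFm.aestronglyMeasurable (Eventually.of_forall fun y => ?_)
    have h : |U (y.1.1, y.1.2.1.1, y.1.2.1.2.1, y.1.2.2.1, y.1.2.2.2, y.1.2.1.2.2) *
        W.toFun (y.2.1, y.1.2.1.1, y.1.2.1.2.1, y.2.2.1, y.2.2.2, y.1.2.1.2.2)| ≤ 1 :=
      abs_mul_unitInterval_le (hU _) ⟨W.toFun _, W.mem_Icc' _⟩
    have := abs_mul_unitInterval_le (abs_mul_unitInterval_le h (a y.1.1)) (g y.2.1)
    rwa [mul_assoc] at this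
  have hre := measurePreserving_regroup (α := I) (β := I × I × I) (γ := I × I) (δ := I)
    (ε := I × I)
  have e1 : (∫ z : (I × I) × ((I × I × I) × ((I × I) × (I × I))),
      U (z.1.1, z.2.1.1, z.2.1.2.1, z.2.2.1.1, z.2.2.1.2, z.2.1.2.2) *
      W.toFun (z.1.2, z.2.1.1, z.2.1.2.1, z.2.2.2.1, z.2.2.2.2, z.2.1.2.2) *
      ((a z.1.1 : ℝ) * (g z.1.2 : ℝ))) = ∫ y, F y := by
    rw [← hre.map_eq, integral_map hre.measurable.aemeasurable hFm.aestronglyMeasurable]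
  have e2 : ∫ y, F y = ∫ z : I × ((I × I × I) × (I × I)),
      U (z.1, z.2.1.1, z.2.1.2.1, z.2.2.1, z.2.2.2, z.2.1.2.2) *
        ((a z.1 : ℝ) * (W.edgeAverage g z.2.1 : ℝ)) := by
    rw [Measure.volume_eq_prod, integral_prod _ hFi]
    refine integral_congr_ae (Eventually.of_forall fun z => ?_)
    simp only [F, edgeAverage]
    rw [← integral_const_mul, ← integral_const_mul]
    refine integral_congr_ae (Eventually.of_forall fun w => ?_)
    simp only
    ring
  have hGm := (W.isCutTest_edgeAverage hg).1
  have hm : Measurable (fun p : I × I × I × I × I × I =>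
      U p * ((a p.1 : ℝ) * (W.edgeAverage g (p.2.1, p.2.2.1, p.2.2.2.2.2) : ℝ))) :=
    hUm.mul ((measurable_subtype_coe.comp (ha.comp measurable_fst)).mul
      (measurable_subtype_coe.comp (hGm.comp
        (g := W.edgeAverage g) (f := fun p : I × I × I × I × I × I =>
          (p.2.1, p.2.2.1, p.2.2.2.2.2)) (by fun_prop))))
  have hasm := volume_preserving_assembleVertexPair
  have e3 : (∫ z : I × ((I × I × I) × (I × I)),
      U (z.1, z.2.1.1, z.2.1.2.1, z.2.2.1, z.2.2.2, z.2.1.2.2) *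
        ((a z.1 : ℝ) * (W.edgeAverage g z.2.1 : ℝ))) = ∫ p : I × I × I × I × I × I,
      U p * ((a p.1 : ℝ) * (W.edgeAverage g (p.2.1, p.2.2.1, p.2.2.2.2.2) : ℝ)) := by
    rw [← hasm.map_eq, integral_map hasm.measurable.aemeasurable hm.aestronglyMeasurable]
  rw [e1, e2, e3]
  exact abs_integral_vertex_mul_edge_le hUm hU ha (W.isCutTest_edgeAverage hg)

/-- Rotating the second factor puts vertex 4 first, so that vertices 1 and 4 play the same role. -/
theorem interFun_eq (W : Hypergraphon3) (q : I × I) :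
    W.interFun q = (1 / 2) * ∫ p : (I × I × I) × (I × I) × (I × I),
      W.toFun (q.1, p.1.1, p.1.2.1, p.2.1.1, p.2.1.2, p.1.2.2) *
      W.toFun (q.2, p.1.1, p.1.2.1, p.2.2.1, p.2.2.2, p.1.2.2) := by
  unfold interFun
  congr 1
  refine integral_congr_ae (Eventually.of_forall ?_)
  rintro ⟨⟨x₂, x₃, x₂₃⟩, ⟨x₁₂, x₁₃⟩, ⟨x₂₄, x₃₄⟩⟩
  change W.toFun (q.1, x₂, x₃, x₁₂, x₁₃, x₂₃) * W.toFun (x₂, x₃, q.2, x₂₃, x₂₄, x₃₄) =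
    W.toFun (q.1, x₂, x₃, x₁₂, x₁₃, x₂₃) * W.toFun (q.2, x₂, x₃, x₂₄, x₃₄, x₂₃)
  rw [W.rotate q.2]

theorem integrable_glue {U V : I × I × I × I × I × I → ℝ} (hUm : Measurable U)
    (hVm : Measurable V) (hU : ∀ p, |U p| ≤ 1) (hV : ∀ p, |V p| ≤ 1) {f g : I → I}
    (hf : Measurable f) (hg : Measurable g) :
    Integrable (fun z : (I × I) × ((I × I × I) × ((I × I) × (I × I))) =>
      U (z.1.1, z.2.1.1, z.2.1.2.1, z.2.2.1.1, z.2.2.1.2, z.2.1.2.2) *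
      V (z.1.2, z.2.1.1, z.2.1.2.1, z.2.2.2.1, z.2.2.2.2, z.2.1.2.2) *
      ((f z.1.1 : ℝ) * (g z.1.2 : ℝ))) := by
  refine Integrable.of_bound (C := 1) (by fun_prop) (Eventually.of_forall fun z => ?_)
  rw [Real.norm_eq_abs, ← mul_assoc]
  refine abs_mul_unitInterval_le (abs_mul_unitInterval_le ?_ _) _
  rw [abs_mul]
  exact mul_le_one₀ (hU _) (abs_nonneg _) (hV _)

theorem integral_interFun_mul (W : Hypergraphon3) {f g : I → I} (hf : Measurable f)
    (hg : Measurable g) :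
    ∫ q : I × I, W.interFun q * (f q.1 : ℝ) * (g q.2 : ℝ) =
      (1 / 2) * ∫ z : (I × I) × ((I × I × I) × ((I × I) × (I × I))),
        W.toFun (z.1.1, z.2.1.1, z.2.1.2.1, z.2.2.1.1, z.2.2.1.2, z.2.1.2.2) *
        W.toFun (z.1.2, z.2.1.1, z.2.1.2.1, z.2.2.2.1, z.2.2.2.2, z.2.1.2.2) *
        ((f z.1.1 : ℝ) * (g z.1.2 : ℝ)) := by
  have hi := integrable_glue W.measurable' W.measurable' W.abs_toFun_le_one W.abs_toFun_le_one hf hg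
  rw [Measure.volume_eq_prod ((I × I)) ((I × I × I) × ((I × I) × (I × I))), integral_prod _ hi,
    ← integral_const_mul]
  refine integral_congr_ae (Eventually.of_forall fun q => ?_)
  simp only
  rw [integral_mul_const, interFun_eq]
  ring

/-- Exchanging vertices 1 and 4 reduces the term with the difference in the second factor to the one
with it in the first. -/
theorem integral_glue_swap (U V : I × I × I × I × I × I → ℝ) (f g : I → I) :
    (∫ z : (I × I) × ((I × I × I) × ((I × I) × (I × I))),
      U (z.1.1, z.2.1.1, z.2.1.2.1, z.2.2.1.1, z.2.2.1.2, z.2.1.2.2) *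
      V (z.1.2, z.2.1.1, z.2.1.2.1, z.2.2.2.1, z.2.2.2.2, z.2.1.2.2) *
      ((f z.1.1 : ℝ) * (g z.1.2 : ℝ))) =
    ∫ z : (I × I) × ((I × I × I) × ((I × I) × (I × I))),
      V (z.1.1, z.2.1.1, z.2.1.2.1, z.2.2.1.1, z.2.2.1.2, z.2.1.2.2) *
      U (z.1.2, z.2.1.1, z.2.1.2.1, z.2.2.2.1, z.2.2.2.2, z.2.1.2.2) *
      ((g z.1.1 : ℝ) * (f z.1.2 : ℝ)) := by
  have hm : MeasurePreserving (fun z : (I × I) × ((I × I × I) × ((I × I) × (I × I))) =>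
      (z.1.swap, (z.2.1, z.2.2.swap))) volume volume :=
    (Measure.measurePreserving_swap (μ := (volume : Measure I)) (ν := (volume : Measure I))).prod
      ((MeasurePreserving.id (volume : Measure (I × I × I))).prod
        (Measure.measurePreserving_swap (μ := (volume : Measure (I × I)))
          (ν := (volume : Measure (I × I)))))
  have he : MeasurableEmbedding (fun z : (I × I) × ((I × I × I) × ((I × I) × (I × I))) =>
      (z.1.swap, (z.2.1, z.2.2.swap))) :=
    ((MeasurableEquiv.prodComm (α := I) (β := I)).prodCongr
      ((MeasurableEquiv.refl (I × I × I)).prodCongr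
        (MeasurableEquiv.prodComm (α := I × I) (β := I × I)))).measurableEmbedding
  rw [← hm.integral_comp he]
  refine integral_congr_ae (Eventually.of_forall fun z => ?_)
  simp only [Prod.fst_swap, Prod.snd_swap]
  ring

/-- Write `W⊗W - W'⊗W' = (W - W')⊗W + W'⊗(W - W')`. Each term is at most 3 times the 2-cut norm, and
the factor `1/2` in `B` compensates for there being two. -/
theorem cutNorm_inter_sub_le (W W' : Hypergraphon3) :
    cutNorm (fun p => W.inter.toFun p - W'.inter.toFun p) ≤
      3 * cutNorm2 (fun p => W.toFun p - W'.toFun p) := by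
  refine cutNorm_le fun f g hf hg => ?_
  have hUm : Measurable (fun p => W.toFun p - W'.toFun p) := W.measurable'.sub W'.measurable'
  have hU := W.abs_toFun_sub_le_one W'
  have hint : ∀ X : Hypergraphon3,
      Integrable (fun q : I × I => X.interFun q * (f q.1 : ℝ) * (g q.2 : ℝ)) := fun X => by
    have hX := X.interFun_measurable
    refine Integrable.of_bound (C := 1) (by fun_prop) (Eventually.of_forall fun q => ?_)
    refine abs_mul_unitInterval_le (abs_mul_unitInterval_le ?_ _) _
    rw [abs_of_nonneg (X.interFun_mem_Icc q).1]
    exact (X.interFun_mem_Icc q).2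
  have i1 := integrable_glue hUm W.measurable' hU W.abs_toFun_le_one hf hg
  have i2 := integrable_glue W'.measurable' hUm W'.abs_toFun_le_one hU hf hg
  have iW := integrable_glue W.measurable' W.measurable' W.abs_toFun_le_one W.abs_toFun_le_one hf hg
  have iW' := integrable_glue W'.measurable' W'.measurable' W'.abs_toFun_le_one
    W'.abs_toFun_le_one hf hg
  have b1 := abs_integral_glue_le hUm hU W hf hg
  have b2 := abs_integral_glue_le hUm hU W' hg hf
  rw [← integral_glue_swap W'.toFun (fun p => W.toFun p - W'.toFun p) f g] at b2
  have hdiff := (integral_sub' iW iW').symm.trans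
    ((integral_congr_ae (Eventually.of_forall fun z => by
      simp only [Pi.sub_apply, Pi.add_apply]
      ring)).trans (integral_add' i1 i2))
  have key : ∫ q : I × I, (W.inter.toFun q - W'.inter.toFun q) * (f q.1 : ℝ) * (g q.2 : ℝ) =
      ∫ q : I × I, (W.interFun q * (f q.1 : ℝ) * (g q.2 : ℝ) -
          W'.interFun q * (f q.1 : ℝ) * (g q.2 : ℝ)) := by
    refine integral_congr_ae (Eventually.of_forall fun q => ?_)
    change (W.interFun q - W'.interFun q) * _ * _ = _
    ring
  rw [key, integral_sub (hint W) (hint W'), integral_interFun_mul _ hf hg,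
    integral_interFun_mul _ hf hg, ← mul_sub, hdiff]
  rw [abs_le] at b1 b2 ⊢
  constructor <;> linarith [b1.1, b1.2, b2.1, b2.2]

end Hypergraphon3

theorem mainTheorem4 (W : ℕ → Hypergraphon3) (W₀ : Hypergraphon3)
    (hconv : Tendsto (fun n => cutNorm2 (fun p => (W n).toFun p - W₀.toFun p)) atTop (𝓝 0)) :
    Tendsto (fun n => cutNorm (fun p => (W n).inter.toFun p - W₀.inter.toFun p)) atTop (𝓝 0) ∧
      SpectraConverge (fun n => (W n).inter.kernelOp) W₀.inter.kernelOp := by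
  have h : Tendsto (fun n => cutNorm (fun p => (W n).inter.toFun p - W₀.inter.toFun p))
      atTop (𝓝 0) := by
    refine squeeze_zero (fun n => cutNorm_nonneg _) (fun n => (W n).cutNorm_inter_sub_le W₀) ?_
    simpa using hconv.const_mul 3
  exact ⟨h, Graphon.spectraConverge_kernelOp h⟩
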